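/- Let $n,s,m$ be positive integers with $n\ge 3s$. A binary form of degree $n$ is a homogeneous polynomial of degree $n$ in two variables. For an integer $t\ge 0$ let $C(t)$ be the set of binary forms $F(x,y)\in\mathbb{Z}[x,y]$ of degree $n$ that are irreducible over $\mathbb{Q}$ and such that, for all reals $(u,v)\neq(0,0)$, the form $u\,\partial F/\partial x+v\,\partial F/\partial y$ has at most $t$ distinct zeros in $\mathbb{P}^1(\mathbb{R})$. For a form $G(x,y)=a_n(x-\gamma_1y)\cdots(x-\gamma_ny)$ with $a_n\ne0$, let $M(G)=|a_n|\prod_{i=1}^n\max(1,|\gamma_i|)$ be its Mahler measure. Two forms $F,G$ are equivalent if $G(x,y)=\pm F(ax+by,cx+dy)$ for some $\begin{pmatrix}a&b\\c&d\end{pmatrix}\in GL_2(\mathbb{Z})$. Put $$R=n^{800\log^2 n},\qquad Y_S=\bigl((e^6s)^nR^{2s}m\bigr)^{\frac1{n-2s}}.$$ Let $F\in C(4s-2)$ have degree $n$, let $M$ be the smallest Mahler measure among the forms equivalent to $F$, and suppose that $m\le M/100^n$. Let $\tilde P_{S_x}(F,m)$ and $\tilde P_{S_y}(F,m)$ be the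 numbers of pairs $(x,y)\in\mathbb{Z}^2$ with $\gcd(x,y)=1$ and $$2^{-n}m\le F(x,y)<m$$ that satisfy $0\le x\le Y_S$ and $0\le y\le Y_S$, respectively. Then both numbers are finite and $$\max\bigl(\tilde P_{S_x}(F,m),\tilde P_{S_y}(F,m)\bigr)\ll s+\log^3 n+\log m^{1/n},$$ where the implied constant is absolute. -/

import Mathlib

namespace ThueForms

noncomputable section

/-- `F_A(x, y) = F(a x + b y, c x + d y)` for `A = (a b; c d)`. -/
def act (A : Matrix (Fin 2) (Fin 2) ℤ) (F : MvPolynomial (Fin 2) ℤ) : MvPolynomial (Fin 2) ℤ :=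
  MvPolynomial.bind₁
    (fun i => MvPolynomial.C (A i 0) * MvPolynomial.X 0 +
      MvPolynomial.C (A i 1) * MvPolynomial.X 1) F

/-- `F` and `G` are equivalent if `G = ± F_A` for some `A ∈ GL₂(ℤ)`. -/
def Equivalent (F G : MvPolynomial (Fin 2) ℤ) : Prop :=
  ∃ A : Matrix.GeneralLinearGroup (Fin 2) ℤ,
    G = act (A : Matrix (Fin 2) (Fin 2) ℤ) F ∨ G = -act (A : Matrix (Fin 2) (Fin 2) ℤ) F

/-- The zeros of a real binary form in the real projective line. -/
def realZeros (G : MvPolynomial (Fin 2) ℝ) : Set (Projectivization ℝ (Fin 2 → ℝ)) :=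
  {P | ∀ v ∈ P.submodule, MvPolynomial.eval v G = 0}

/-- `F` with coefficients regarded as real numbers. -/
def toReal (F : MvPolynomial (Fin 2) ℤ) : MvPolynomial (Fin 2) ℝ :=
  MvPolynomial.map (Int.castRingHom ℝ) F

/-- The class `C(t)` of forms of degree `n`: integral binary forms, irreducible over `ℚ`, such that
for all reals `(u, v) ≠ (0, 0)` the form `u F_x + v F_y` has at most `t` (distinct) real zeros. -/
structure ClassC (n t : ℕ) (F : MvPolynomial (Fin 2) ℤ) : Prop where
  homogeneous : F.IsHomogeneous n
  irreducible : Irreducible (MvPolynomial.map (Int.castRingHom ℚ) F)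
  few_zeros : ∀ u v : ℝ, (u, v) ≠ (0, 0) →
    (realZeros (MvPolynomial.C u * MvPolynomial.pderiv 0 (toReal F) +
      MvPolynomial.C v * MvPolynomial.pderiv 1 (toReal F))).encard ≤ t

/-- The Mahler measure `M(F)` of a binary form, i.e. the Mahler measure of `F(x, 1)`. -/
def mahler (F : MvPolynomial (Fin 2) ℤ) : ℝ :=
  (MvPolynomial.aeval ![(Polynomial.X : Polynomial ℂ), 1] F).mahlerMeasure

/-- `M(F) = |a| ∏ max(1, |γᵢ|)` with `a` the leading coefficient and `γᵢ` the roots of `F(x, 1)`. -/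
theorem mahler_eq (F : MvPolynomial (Fin 2) ℤ) :
    mahler F =
      ‖(MvPolynomial.aeval ![(Polynomial.X : Polynomial ℂ), 1] F).leadingCoeff‖ *
        ((MvPolynomial.aeval ![(Polynomial.X : Polynomial ℂ), 1] F).roots.map
          (fun γ => max 1 ‖γ‖)).prod :=
  Polynomial.mahlerMeasure_eq_leadingCoeff_mul_prod_roots _

/-- The smallest Mahler measure among the forms equivalent to `F`. -/
def minMahler (F : MvPolynomial (Fin 2) ℤ) : ℝ :=
  sInf {M : ℝ | ∃ G, Equivalent F G ∧ M = mahler G}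

/-- `R = n ^ (800 log² n)`. -/
def R (n : ℕ) : ℝ := (n : ℝ) ^ (800 * Real.log n ^ 2)

/-- `Y_S = ((e⁶ s)ⁿ R^{2s} m)^{1/(n-2s)}`. -/
def YS (n s m : ℕ) : ℝ :=
  ((Real.exp 6 * s) ^ n * R n ^ (2 * s) * m) ^ (1 / ((n : ℝ) - 2 * s))

/-- `(x, y)` is a primitive solution of `2^{-n} m ≤ F(x, y) < m`. -/
def IsPrimitiveSolution (n m : ℕ) (F : MvPolynomial (Fin 2) ℤ) (x y : ℤ) : Prop :=
  IsCoprime x y ∧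
    (2 : ℝ) ^ (-(n : ℤ)) * m ≤ (MvPolynomial.eval ![x, y] F : ℤ) ∧
    ((MvPolynomial.eval ![x, y] F : ℤ) : ℝ) < m

/-- The primitive solutions with `0 ≤ x ≤ Y_S`. -/
def smallX (n s m : ℕ) (F : MvPolynomial (Fin 2) ℤ) : Set (ℤ × ℤ) :=
  {p | IsPrimitiveSolution n m F p.1 p.2 ∧ 0 ≤ p.1 ∧ (p.1 : ℝ) ≤ YS n s m}

/-- The primitive solutions with `0 ≤ y ≤ Y_S`. -/
def smallY (n s m : ℕ) (F : MvPolynomial (Fin 2) ℤ) : Set (ℤ × ℤ) :=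
  {p | IsPrimitiveSolution n m F p.1 p.2 ∧ 0 ≤ p.2 ∧ (p.2 : ℝ) ≤ YS n s m}

end

end ThueForms

/-!
Let `k` bound the number of critical points of `F(·, 1)`. Outside `2k + 2` exceptional slopes, the
slope `x / y` of a solution lies between two neighbouring slopes with `F(·, 1)` monotone in between.
Hence, on the segment from `x / y` to one of these neighbours, `F(·, 1)` is largest at `x / y`,
and a maximum modulus argument, with the segment lifted to the unit circle, shows that every complex
root `α` is at least `1 / (144 * n ^ 4)` times as far from `x / y` as that neighbour. As the slopes
of solutions with `1 ≤ y ≤ Y` are `1 / (y * Y)` apart, the proximity `1 / (2 * |x - α * y|)` is at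
most `B = 72 * n ^ 4 * Y`.

For each root, the gap principle then bounds the product of `max 1 (proximity / y)` over the
solutions by `B`. For each solution, the product over the `n` roots is at least `3 ^ n`: otherwise
completing `(x, y)` to a basis of `ℤ²` would give an equivalent form of too small Mahler measure.
Comparing the two products, there are at most `log B` nonexceptional solutions.
-/

namespace ThueForms

open Polynomial

section MaximumModulus

theorem norm_coeff_le_of_norm_eval_le (q : ℂ[X]) {C : ℝ}
    (hC : ∀ w : ℂ, ‖w‖ = 1 → ‖q.eval w‖ ≤ C) (k : ℕ) : ‖q.coeff k‖ ≤ C := by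
  have hC₀ : 0 ≤ C := (norm_nonneg _).trans (hC 1 norm_one)
  by_cases hk : k ∈ q.support
  · have hcont : Continuous fun w : ℂ => ‖q.eval w‖ ^ 2 := by fun_prop
    have hmean : Real.circleAverage (fun w => ‖q.eval w‖ ^ 2) 0 1 ≤ C ^ 2 :=
      Real.circleAverage_mono_on_of_le_circle hcont.continuousOn.circleIntegrable' fun w hw =>
        pow_le_pow_left₀ (norm_nonneg _) (hC w (by simpa using hw)) 2
    refine le_of_sq_le_sq ?_ hC₀
    calc ‖q.coeff k‖ ^ 2 ≤ ∑ i ∈ q.support, ‖q.coeff i‖ ^ 2 :=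
          Finset.single_le_sum (f := fun i => ‖q.coeff i‖ ^ 2) (fun i _ => sq_nonneg _) hk
      _ ≤ C ^ 2 := q.sum_sq_norm_coeff_eq_circleAverage.trans_le hmean
  · rwa [notMem_support_iff.1 hk, norm_zero]

theorem norm_pow_sub_one_le {A : Type*} [NormedRing A] {w : A} (hw : ‖w‖ ≤ 1) (k : ℕ) :
    ‖w ^ k - 1‖ ≤ k * ‖w - 1‖ := by
  induction k with
  | zero => simp
  | succ k ih =>
    calc ‖w ^ (k + 1) - 1‖ = ‖w * (w ^ k - 1) + (w - 1)‖ := by rw [pow_succ']; congr 1; noncomm_ring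
      _ ≤ ‖w‖ * ‖w ^ k - 1‖ + ‖w - 1‖ :=
        (norm_add_le _ _).trans (add_le_add_left (norm_mul_le _ _) _)
      _ ≤ 1 * (k * ‖w - 1‖) + ‖w - 1‖ := by gcongr
      _ = (k + 1 : ℕ) * ‖w - 1‖ := by push_cast; ring

theorem norm_eval_one_le_of_isRoot {q : ℂ[X]} {C : ℝ} {d : ℕ} (hd : q.natDegree ≤ d)
    (hC : ∀ w : ℂ, ‖w‖ = 1 → ‖q.eval w‖ ≤ C) {w : ℂ} (hw : ‖w‖ ≤ 1) (hroot : q.IsRoot w) :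
    ‖q.eval 1‖ ≤ (d + 1) * (C * (d * ‖w - 1‖)) := by
  have hC₀ : 0 ≤ C := (norm_nonneg _).trans (hC 1 norm_one)
  have hdiff : q.eval 1 = -∑ k ∈ Finset.range (d + 1), q.coeff k * (w ^ k - 1) := by
    rw [eval_eq_sum_range' (Nat.lt_succ_of_le hd) 1]
    simp only [one_pow, mul_sub, Finset.sum_sub_distrib, mul_one]
    rw [← eval_eq_sum_range' (Nat.lt_succ_of_le hd) w, hroot.eq_zero]
    ring
  have hterm : ∀ k ∈ Finset.range (d + 1), ‖q.coeff k * (w ^ k - 1)‖ ≤ C * (d * ‖w - 1‖) := by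
    intro k hk
    have hkd : k ≤ d := Finset.mem_range_succ_iff.1 hk
    rw [norm_mul]
    gcongr
    · exact norm_coeff_le_of_norm_eval_le q hC k
    · exact (norm_pow_sub_one_le hw k).trans (by gcongr)
  rw [hdiff, norm_neg]
  exact (norm_sum_le_of_le _ hterm).trans_eq (by simp)

/-- The two solutions of the equation have product `1`, so one of them lies in the unit disc. -/
theorem exists_norm_le_one_sub_one_sq_eq (σ : ℂ) :
    ∃ w : ℂ, ‖w‖ ≤ 1 ∧ (w - 1) ^ 2 = -4 * σ * w := by
  obtain ⟨r, hr⟩ := IsAlgClosed.exists_pow_nat_eq (σ ^ 2 - σ) two_pos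
  have hprod : ‖1 - 2 * σ + 2 * r‖ * ‖1 - 2 * σ - 2 * r‖ = 1 := by
    rw [← norm_mul, ← norm_one (α := ℂ)]
    congr 1
    linear_combination -4 * hr
  rcases le_total ‖1 - 2 * σ + 2 * r‖ 1 with h | h
  · exact ⟨_, h, by linear_combination 4 * hr⟩
  · exact ⟨_, (le_mul_of_one_le_left (norm_nonneg _) h).trans_eq hprod,
      by linear_combination 4 * hr⟩

theorem sub_one_sq_eq_of_norm_eq_one {w : ℂ} (hw : ‖w‖ = 1) :
    (w - 1) ^ 2 = -4 * ((‖w - 1‖ ^ 2 / 4 : ℝ) : ℂ) * w := by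
  have hw₁ : w * starRingEnd ℂ w = 1 := by rw [Complex.mul_conj']; simp [hw]
  push_cast
  rw [← Complex.mul_conj', map_sub, map_one]
  linear_combination (w - 1) * hw₁

/-- The polynomial `w ^ n * Q(-(w - 1) ^ 2 / (4 * w))`. The substitution maps the unit circle
onto the segment `[0, 1]` and `1` to `0`, so that bounds for `Q` on the segment become bounds on
the circle. -/
noncomputable def circleLift (n : ℕ) (Q : ℂ[X]) : ℂ[X] :=
  MvPolynomial.aeval ![C (-1 / 4) * (X - 1) ^ 2, X] (Q.homogenize n)

theorem natDegree_circleLift_le (n : ℕ) (Q : ℂ[X]) : (circleLift n Q).natDegree ≤ n * 2 := by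
  refine MvPolynomial.aeval_natDegree_le _ (isHomogeneous_homogenize Q).totalDegree_le _ fun i => ?_
  fin_cases i
  · change (C (-1 / 4) * (X - 1) ^ 2 : ℂ[X]).natDegree ≤ 2
    compute_degree
  · simp

theorem eval_circleLift {n : ℕ} {Q : ℂ[X]} (hQ : Q.natDegree ≤ n) {w σ : ℂ}
    (hw : (w - 1) ^ 2 = -4 * σ * w) : (circleLift n Q).eval w = w ^ n * Q.eval σ := by
  have hw₀ : w ≠ 0 := by rintro rfl; simp at hw
  have hσ : -1 / 4 * (w - 1) ^ 2 / w = σ := by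
    rw [div_eq_iff hw₀]
    linear_combination -1 / 4 * hw
  calc (circleLift n Q).eval w
      = MvPolynomial.eval ![-1 / 4 * (w - 1) ^ 2, w] (Q.homogenize n) := by
        rw [circleLift, ← coe_evalRingHom, MvPolynomial.map_aeval, MvPolynomial.eval,
          MvPolynomial.coe_eval₂Hom, MvPolynomial.coe_eval₂Hom]
        congr 1
        · ext; simp
        · ext i; fin_cases i <;> simp
    _ = w ^ n * Q.eval σ := by
        rw [eval_homogenize hQ _ (by simpa using hw₀)]
        simp [hσ, mul_comm]

theorem one_le_mul_norm_of_isRoot {n : ℕ} {Q : ℂ[X]} (hQ : Q.natDegree ≤ n)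
    (hmax : ∀ t : ℝ, t ∈ Set.Icc 0 1 → ‖Q.eval (t : ℂ)‖ ≤ ‖Q.eval 0‖) (hQ₀ : Q.eval 0 ≠ 0) {σ : ℂ}
    (hroot : Q.IsRoot σ) : 1 ≤ 144 * (n : ℝ) ^ 4 * ‖σ‖ := by
  have hcircle : ∀ w : ℂ, ‖w‖ = 1 → ‖(circleLift n Q).eval w‖ ≤ ‖Q.eval 0‖ := by
    intro w hw
    have hw₁ : ‖w - 1‖ ≤ 2 := (norm_sub_le _ _).trans (by rw [hw, norm_one]; norm_num)
    rw [eval_circleLift hQ (sub_one_sq_eq_of_norm_eq_one hw), norm_mul, norm_pow, hw, one_pow,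
      one_mul]
    exact hmax _ ⟨by positivity, by nlinarith [norm_nonneg (w - 1)]⟩
  obtain ⟨w, hw, hwσ⟩ := exists_norm_le_one_sub_one_sq_eq σ
  have hlift : (circleLift n Q).IsRoot w := by
    rw [IsRoot, eval_circleLift hQ hwσ, hroot.eq_zero, mul_zero]
  have hone := norm_eval_one_le_of_isRoot (natDegree_circleLift_le n Q) hcircle hw hlift
  rw [eval_circleLift (σ := 0) hQ (by simp), one_pow, one_mul] at hone
  have hdist : 1 ≤ (2 * (n : ℝ) + 1) * (2 * n * ‖w - 1‖) := by
    refine le_of_mul_le_mul_right ?_ (norm_pos_iff.2 hQ₀)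
    push_cast at hone
    linarith
  have hn : (1 : ℝ) ≤ n := by
    rcases n.eq_zero_or_pos with rfl | hn
    · norm_num at hdist
    · exact_mod_cast hn
  have hdist' : 1 ≤ 6 * (n : ℝ) ^ 2 * ‖w - 1‖ := by
    calc 1 ≤ (2 * (n : ℝ) + 1) * (2 * n * ‖w - 1‖) := hdist
      _ ≤ (2 * (n : ℝ) + n) * (2 * n * ‖w - 1‖) := by gcongr
      _ = 6 * (n : ℝ) ^ 2 * ‖w - 1‖ := by ring
  calc 1 ≤ (6 * (n : ℝ) ^ 2 * ‖w - 1‖) ^ 2 := one_le_pow₀ hdist'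
    _ = 36 * (n : ℝ) ^ 4 * ‖(w - 1) ^ 2‖ := by rw [norm_pow]; ring
    _ = 36 * (n : ℝ) ^ 4 * (4 * ‖σ‖ * ‖w‖) := by rw [hwσ]; simp
    _ ≤ 36 * (n : ℝ) ^ 4 * (4 * ‖σ‖ * 1) := by gcongr
    _ = 144 * (n : ℝ) ^ 4 * ‖σ‖ := by ring

theorem norm_sub_le_mul_norm_sub_root {n : ℕ} {Q : ℂ[X]} (hQ : Q.natDegree ≤ n) {a b : ℂ}
    (hmax : ∀ t : ℝ, t ∈ Set.Icc 0 1 → ‖Q.eval (b + t * (a - b))‖ ≤ ‖Q.eval b‖)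
    (hb : Q.eval b ≠ 0) {α : ℂ} (hroot : Q.IsRoot α) :
    ‖a - b‖ ≤ 144 * (n : ℝ) ^ 4 * ‖b - α‖ := by
  rcases eq_or_ne a b with rfl | hab
  · simp only [sub_self, norm_zero]; positivity
  have hab' : a - b ≠ 0 := sub_ne_zero.2 hab
  have hcomp (z : ℂ) : (Q.comp (C b + C (a - b) * X)).eval z = Q.eval (b + z * (a - b)) := by
    simp [mul_comm z]
  have hdeg : (Q.comp (C b + C (a - b) * X)).natDegree ≤ n :=
    natDegree_comp_le.trans ((Nat.mul_le_mul hQ (by compute_degree)).trans_eq (mul_one n))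
  have hunit := one_le_mul_norm_of_isRoot (σ := (α - b) / (a - b)) hdeg
    (fun t ht => by simpa only [hcomp, zero_mul, add_zero] using hmax t ht)
    (by simpa only [hcomp, zero_mul, add_zero] using hb)
    (by rw [IsRoot, hcomp, div_mul_cancel₀ _ hab', add_sub_cancel, hroot.eq_zero])
  rwa [norm_div, ← mul_div_assoc, one_le_div (norm_pos_iff.2 hab'), norm_sub_rev α] at hunit

end MaximumModulus

section Neighbours

theorem monotoneOn_or_antitoneOn_of_derivative_ne_zero {f : ℝ[X]} {b c : ℝ}
    (hf : ∀ t ∈ Set.Ioo b c, f.derivative.eval t ≠ 0) :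
    MonotoneOn f.eval (Set.Icc b c) ∨ AntitoneOn f.eval (Set.Icc b c) := by
  rcases hasDerivWithinAt_forall_lt_or_forall_gt_of_forall_ne (convex_Ioo b c)
    (fun t _ => (f.hasDerivAt t).hasDerivWithinAt) hf with hneg | hpos
  · refine .inr (antitoneOn_of_deriv_nonpos (convex_Icc b c) f.continuousOn
      f.differentiable.differentiableOn fun t ht => ?_)
    rw [interior_Icc] at ht
    exact f.deriv.trans_le (hneg t ht).le
  · refine .inl (monotoneOn_of_deriv_nonneg (convex_Icc b c) f.continuousOn
      f.differentiable.differentiableOn fun t ht => ?_)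
    rw [interior_Icc] at ht
    exact (hpos t ht).le.trans_eq f.deriv.symm

theorem abs_sub_le_mul_norm_sub_root {n : ℕ} {f : ℝ[X]} (hn : f.natDegree ≤ n) {d x : ℝ}
    (hmax : ∀ u ∈ Set.uIcc d x, |f.eval u| ≤ |f.eval x|) (hx : f.eval x ≠ 0) {α : ℂ}
    (hα : aeval α f = 0) : |d - x| ≤ 144 * (n : ℝ) ^ 4 * ‖x - α‖ := by
  have heval (u : ℝ) : (f.map Complex.ofRealHom).eval (u : ℂ) = ((f.eval u : ℝ) : ℂ) :=
    (eval_map _ _).trans (eval₂_at_apply Complex.ofRealHom u)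
  have hmax' : ∀ t ∈ Set.Icc (0 : ℝ) 1, ‖(f.map Complex.ofRealHom).eval (x + t * (d - x) : ℂ)‖ ≤
      ‖(f.map Complex.ofRealHom).eval (x : ℂ)‖ := by
    intro t ht
    rw [show (x + t * (d - x) : ℂ) = ((x + t * (d - x) : ℝ) : ℂ) by push_cast; rfl, heval, heval,
      Complex.norm_real, Complex.norm_real]
    exact hmax _ ((convex_uIcc d x).add_smul_sub_mem Set.right_mem_uIcc Set.left_mem_uIcc ht)
  have hbound := norm_sub_le_mul_norm_sub_root (natDegree_map_le.trans hn) hmax'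
    (by rwa [heval, Ne, Complex.ofReal_eq_zero]) ((eval_map_algebraMap f α).trans hα)
  rwa [← Complex.ofReal_sub, Complex.norm_real, Real.norm_eq_abs] at hbound

theorem min_sub_le_mul_norm_sub_root {n : ℕ} {f : ℝ[X]} (hn : f.natDegree ≤ n) {b c x : ℝ}
    (hbx : b < x) (hxc : x < c) (hb : 0 < f.eval b) (hx : 0 < f.eval x) (hc : 0 < f.eval c)
    (hcrit : ∀ t ∈ Set.Ioo b c, f.derivative.eval t ≠ 0) {α : ℂ} (hα : aeval α f = 0) :
    min (x - b) (c - x) ≤ 144 * (n : ℝ) ^ 4 * ‖x - α‖ := by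
  have hxmem : x ∈ Set.Icc b c := ⟨hbx.le, hxc.le⟩
  rcases monotoneOn_or_antitoneOn_of_derivative_ne_zero hcrit with hmono | hanti
  · have hmax : ∀ u ∈ Set.uIcc b x, |f.eval u| ≤ |f.eval x| := by
      rw [Set.uIcc_of_le hbx.le]
      rintro u ⟨hbu, hux⟩
      have hu : u ∈ Set.Icc b c := ⟨hbu, hux.trans hxc.le⟩
      have hbmem : b ∈ Set.Icc b c := ⟨le_rfl, (hbx.trans hxc).le⟩
      rw [abs_of_pos (hb.trans_le (hmono hbmem hu hbu)), abs_of_pos hx]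
      exact hmono hu hxmem hux
    have hbound := abs_sub_le_mul_norm_sub_root hn hmax hx.ne' hα
    rw [abs_sub_comm, abs_of_pos (sub_pos.2 hbx)] at hbound
    exact (min_le_left _ _).trans hbound
  · have hmax : ∀ u ∈ Set.uIcc c x, |f.eval u| ≤ |f.eval x| := by
      rw [Set.uIcc_of_ge hxc.le]
      rintro u ⟨hxu, huc⟩
      have hu : u ∈ Set.Icc b c := ⟨hbx.le.trans hxu, huc⟩
      have hcmem : c ∈ Set.Icc b c := ⟨(hbx.trans hxc).le, le_rfl⟩
      rw [abs_of_pos (hc.trans_le (hanti hu hcmem huc)), abs_of_pos hx]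
      exact hanti hxmem hu hxu
    have hbound := abs_sub_le_mul_norm_sub_root hn hmax hx.ne' hα
    rw [abs_of_pos (sub_pos.2 hxc)] at hbound
    exact (min_le_right _ _).trans hbound

theorem exists_card_le_forall_left_neighbour {β : Type*} [LinearOrder β] (A Z : Finset β) :
    ∃ E : Finset β, E.card ≤ Z.card + 1 ∧
      ∀ a ∈ A, a ∉ E → ∃ b ∈ A, b < a ∧ ∀ z ∈ Z, z ∉ Set.Ioc b a := by
  classical
  let least (p : β → Prop) : Finset β := A.filter fun a => IsLeast {b | b ∈ A ∧ p b} a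
  have hleast (p : β → Prop) : (least p).card ≤ 1 :=
    Finset.card_le_one.2 fun a ha b hb =>
      (Finset.mem_filter.1 ha).2.unique (Finset.mem_filter.1 hb).2
  refine ⟨(Z.biUnion fun z => least (z ≤ ·)) ∪ least fun _ => True, ?_, fun a ha hE => ?_⟩
  · refine (Finset.card_union_le _ _).trans (add_le_add ?_ (hleast _))
    exact (Finset.card_biUnion_le_card_mul _ _ 1 fun z _ => hleast _).trans_eq (mul_one _)
  simp only [least, Finset.mem_union, Finset.mem_biUnion, Finset.mem_filter, ha, true_and,
    not_or, not_exists, not_and] at hE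
  obtain ⟨hZ, hmin⟩ := hE
  have hbelow : (A.filter (· < a)).Nonempty := by
    by_contra hempty
    rw [Finset.not_nonempty_iff_eq_empty, Finset.filter_eq_empty_iff] at hempty
    exact hmin ⟨⟨ha, trivial⟩, fun d hd => not_lt.1 (hempty hd.1)⟩
  obtain ⟨b, hb, hmax⟩ := (A.filter (· < a)).exists_max_image id hbelow
  simp only [Finset.mem_filter, id_eq, and_imp] at hb hmax
  refine ⟨b, hb.1, hb.2, fun z hz hzba => hZ z hz ⟨⟨ha, hzba.2⟩, fun d hd => ?_⟩⟩
  by_contra! hda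
  exact (hzba.1.trans_le hd.2).not_ge (hmax d hd.1 hda)

theorem exists_card_le_forall_neighbours {β : Type*} [LinearOrder β] (A Z : Finset β) :
    ∃ E : Finset β, E.card ≤ 2 * Z.card + 2 ∧
      ∀ a ∈ A, a ∉ E → ∃ b ∈ A, ∃ c ∈ A, b < a ∧ a < c ∧ ∀ z ∈ Z, z ∉ Set.Ioo b c := by
  obtain ⟨E, hE, hleft⟩ := exists_card_le_forall_left_neighbour A Z
  obtain ⟨E', hE', hright⟩ : ∃ E' : Finset β, E'.card ≤ Z.card + 1 ∧
      ∀ a ∈ A, a ∉ E' → ∃ c ∈ A, a < c ∧ ∀ z ∈ Z, ¬(z < c ∧ a ≤ z) :=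
    exists_card_le_forall_left_neighbour (β := βᵒᵈ) A Z
  refine ⟨E ∪ E', (Finset.card_union_le _ _).trans (by omega), fun a ha haE => ?_⟩
  rw [Finset.notMem_union] at haE
  obtain ⟨b, hb, hba, hbZ⟩ := hleft a ha haE.1
  obtain ⟨c, hc, hac, hcZ⟩ := hright a ha haE.2
  refine ⟨b, hb, c, hc, hba, hac, fun z hz hzbc => ?_⟩
  rcases le_total z a with hza | haz
  · exact hbZ z hz ⟨hzbc.1, hza⟩
  · exact hcZ z hz ⟨hzbc.2, haz⟩

theorem exists_subset_forall_neighbours {α β : Type*} [LinearOrder β] {f : α → β} {T : Finset α}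
    (hf : Set.InjOn f T) (Z : Finset β) :
    ∃ T' ⊆ T, T.card ≤ T'.card + (2 * Z.card + 2) ∧ ∀ p ∈ T', ∃ q ∈ T, ∃ r ∈ T,
      f q < f p ∧ f p < f r ∧ ∀ z ∈ Z, z ∉ Set.Ioo (f q) (f r) := by
  classical
  obtain ⟨E, hE, hneigh⟩ := exists_card_le_forall_neighbours (T.image f) Z
  refine ⟨T.filter (f · ∉ E), T.filter_subset _, ?_, fun p hp => ?_⟩
  · have hexc : (T.filter (f · ∈ E)).card ≤ E.card :=
      Finset.card_le_card_of_injOn f (fun p hp => (Finset.mem_filter.1 hp).2)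
        (hf.mono (Finset.coe_subset.2 (T.filter_subset _)))
    rw [← Finset.card_filter_add_card_filter_not (s := T) (f · ∈ E)]
    omega
  · obtain ⟨hpT, hpE⟩ := Finset.mem_filter.1 hp
    simpa only [Finset.exists_mem_image] using hneigh (f p) (Finset.mem_image_of_mem f hpT) hpE

end Neighbours

section GapPrinciple

theorem prod_div_le_of_gap {ι : Type*} (S : Finset ι) {y u : ι → ℝ} {B : ℝ}
    (hu : ∀ p ∈ S, u p ≤ B) (hyu : ∀ p ∈ S, y p ≤ u p)
    (hgap : ∀ p ∈ S, ∀ q ∈ S, p ≠ q → y p ≤ y q → u p ≤ y q) {c : ℝ} (hc : 0 < c) (hcB : c ≤ B)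
    (hcy : ∀ p ∈ S, c ≤ y p) : ∏ p ∈ S, u p / y p ≤ B / c := by
  classical
  induction S using Finset.induction_on_min_value y generalizing c with
  | empty => simpa using (one_le_div hc).2 hcB
  | insert a S ha hmin ih =>
    simp only [Finset.forall_mem_insert] at hu hyu hcy hgap
    have hya : 0 < y a := hc.trans_le hcy.1
    have hua : 0 < u a := hya.trans_le hyu.1
    have htail : ∏ p ∈ S, u p / y p ≤ B / u a :=
      ih hu.2 hyu.2 (fun p hp => (hgap.2 p hp).2) hua hu.1 fun p hp =>
        hgap.1.2 p hp (ne_of_mem_of_not_mem hp ha).symm (hmin p hp)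
    rw [Finset.prod_insert ha]
    calc u a / y a * ∏ p ∈ S, u p / y p ≤ u a / y a * (B / u a) := by gcongr
      _ = B / y a := by field_simp
      _ ≤ B / c := by
        have hB : 0 < B := hc.trans_le hcB
        gcongr
        exact hcy.1

theorem prod_max_one_div_le_of_gap {ι : Type*} (S : Finset ι) {y u : ι → ℝ} {B : ℝ}
    (hB : 1 ≤ B) (hy : ∀ p ∈ S, 1 ≤ y p) (hu : ∀ p ∈ S, u p ≤ B)
    (hgap : ∀ p ∈ S, ∀ q ∈ S, p ≠ q → y p ≤ y q → y q ≤ u q → u p ≤ y q) :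
    ∏ p ∈ S, max 1 (u p / y p) ≤ B := by
  classical
  have hfilter : ∏ p ∈ S, max 1 (u p / y p) = ∏ p ∈ S with y p ≤ u p, u p / y p := by
    rw [Finset.prod_filter]
    refine Finset.prod_congr rfl fun p hp => ?_
    have hyp : 0 < y p := one_pos.trans_le (hy p hp)
    split_ifs with h
    · exact max_eq_right ((one_le_div hyp).2 h)
    · exact max_eq_left ((div_le_one hyp).2 (not_le.1 h).le)
  rw [hfilter, ← div_one B]
  refine prod_div_le_of_gap _ ?_ ?_ ?_ one_pos hB ?_ <;> simp only [Finset.mem_filter, and_imp]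
  · exact fun p hp _ => hu p hp
  · exact fun p _ h => h
  · exact fun p hp _ q hq hyu hpq hle => hgap p hp q hq hpq hle hyu
  · exact fun p hp _ => hy p hp

end GapPrinciple

section LinearForms

/-- For the linear form `β * x + γ * y` this is `1 / (2 * |x - α * y|)`, where `α = -γ / β` is its
root. It is `0` if `β = 0`, and by convention at the zeros of the form. -/
noncomputable def proximity (β γ : ℂ) (p : ℤ × ℤ) : ℝ :=
  ‖β‖ / (2 * ‖β * p.1 + γ * p.2‖)

theorem det_ne_zero_of_isCoprime {p q : ℤ × ℤ} (hp : IsCoprime p.1 p.2) (hq : IsCoprime q.1 q.2)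
    (hp₂ : 1 ≤ p.2) (hq₂ : 1 ≤ q.2) (hpq : p ≠ q) : p.1 * q.2 - q.1 * p.2 ≠ 0 := by
  intro hdet
  have hdvd : p.2 ∣ q.2 := hp.symm.dvd_of_dvd_mul_left ⟨q.1, by linarith⟩
  have hdvd' : q.2 ∣ p.2 := hq.symm.dvd_of_dvd_mul_left ⟨p.1, by linarith⟩
  have heq : p.2 = q.2 := Int.dvd_antisymm (by omega) (by omega) hdvd hdvd'
  rw [← heq, ← sub_mul] at hdet
  exact hpq (Prod.ext (sub_eq_zero.1 (eq_zero_of_ne_zero_of_mul_right_eq_zero (by omega) hdet)) heq)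

theorem norm_le_add_of_det_ne_zero (β γ : ℂ) {p q : ℤ × ℤ} (hp : 0 ≤ p.2) (hq : 0 ≤ q.2)
    (hdet : p.1 * q.2 - q.1 * p.2 ≠ 0) :
    ‖β‖ ≤ q.2 * ‖β * p.1 + γ * p.2‖ + p.2 * ‖β * q.1 + γ * q.2‖ := by
  have hnorm {z : ℤ} (hz : 0 ≤ z) : ‖(z : ℂ)‖ = z := by
    rw [Complex.norm_intCast, abs_of_nonneg (by exact_mod_cast hz)]
  have hdet' : (1 : ℝ) ≤ ‖((p.1 * q.2 - q.1 * p.2 : ℤ) : ℂ)‖ := by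
    rw [Complex.norm_intCast]
    exact_mod_cast Int.one_le_abs hdet
  calc ‖β‖ ≤ ‖β‖ * ‖((p.1 * q.2 - q.1 * p.2 : ℤ) : ℂ)‖ :=
        le_mul_of_one_le_right (norm_nonneg _) hdet'
    _ = ‖q.2 * (β * p.1 + γ * p.2) - p.2 * (β * q.1 + γ * q.2)‖ := by
        rw [← norm_mul]; congr 1; push_cast; ring
    _ ≤ _ := (norm_sub_le _ _).trans_eq (by rw [norm_mul, norm_mul, hnorm hp, hnorm hq])

theorem proximity_le_of_le_proximity {β γ : ℂ} {p q : ℤ × ℤ} (hp : 1 ≤ p.2) (hpq : p.2 ≤ q.2)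
    (hdet : p.1 * q.2 - q.1 * p.2 ≠ 0) (hq : q.2 ≤ proximity β γ q) :
    proximity β γ p ≤ q.2 := by
  have hq₂ : (1 : ℝ) ≤ q.2 := by exact_mod_cast hp.trans hpq
  have hclose : 2 * (q.2 * ‖β * q.1 + γ * q.2‖) ≤ ‖β‖ := by
    rcases (norm_nonneg (β * q.1 + γ * q.2)).eq_or_lt with h | h
    · rw [← h]; simp
    · rw [proximity, le_div_iff₀ (by positivity)] at hq
      linarith
  have hle : (p.2 : ℝ) * ‖β * q.1 + γ * q.2‖ ≤ q.2 * ‖β * q.1 + γ * q.2‖ := by gcongr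
  have hdist := norm_le_add_of_det_ne_zero β γ (by omega) (by omega) hdet
  refine div_le_of_le_mul₀ (by positivity) (by linarith) ?_
  linarith

theorem prod_max_one_proximity_div_le (β γ : ℂ) {T : Finset (ℤ × ℤ)} {B : ℝ} (hB : 1 ≤ B)
    (hcop : ∀ p ∈ T, IsCoprime p.1 p.2) (hy : ∀ p ∈ T, 1 ≤ p.2)
    (hT : ∀ p ∈ T, proximity β γ p ≤ B) : ∏ p ∈ T, max 1 (proximity β γ p / p.2) ≤ B := by
  refine prod_max_one_div_le_of_gap T hB (fun p hp => by exact_mod_cast hy p hp) hT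
    fun p hp q hq hne hpq => proximity_le_of_le_proximity (hy p hp) (by exact_mod_cast hpq) ?_
  exact det_ne_zero_of_isCoprime (hcop p hp) (hcop q hq) (hy p hp) (hy q hq) hne

theorem exists_det_eq_one {p : ℤ × ℤ} (hp : IsCoprime p.1 p.2) (hy : 1 ≤ p.2) :
    ∃ q : ℤ × ℤ, p.1 * q.2 - q.1 * p.2 = 1 ∧ 0 ≤ q.2 ∧ q.2 ≤ p.2 := by
  obtain ⟨u, v, huv⟩ := hp
  refine ⟨(-v - p.1 * (u / p.2), u % p.2), ?_, Int.emod_nonneg _ (by omega),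
    (Int.emod_lt_of_pos _ (by omega)).le⟩
  rw [Int.emod_def]
  linarith

theorem norm_le_mul_max_one_proximity_div {β γ : ℂ} {p q : ℤ × ℤ} (hy : 1 ≤ p.2)
    (hdet : p.1 * q.2 - q.1 * p.2 = 1) (hq₀ : 0 ≤ q.2) (hq : q.2 ≤ p.2)
    (hp : β * p.1 + γ * p.2 ≠ 0) :
    ‖β * q.1 + γ * q.2‖ ≤ 3 * ‖β * p.1 + γ * p.2‖ * max 1 (proximity β γ p / p.2) := by
  have hyR : (1 : ℝ) ≤ p.2 := by exact_mod_cast hy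
  have hβ : ‖β‖ = 2 * ‖β * p.1 + γ * p.2‖ * proximity β γ p := by
    rw [proximity, mul_div_cancel₀ _ (by simpa using hp)]
  have hscaled : p.2 * ‖β * q.1 + γ * q.2‖ ≤ p.2 * ‖β * p.1 + γ * p.2‖ + ‖β‖ := by
    have hdetC : (p.1 * q.2 - q.1 * p.2 : ℂ) = 1 := by exact_mod_cast hdet
    calc p.2 * ‖β * q.1 + γ * q.2‖ = ‖(p.2 : ℂ) * (β * q.1 + γ * q.2)‖ := by
          rw [norm_mul, Complex.norm_intCast, abs_of_pos (by linarith)]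
      _ = ‖q.2 * (β * p.1 + γ * p.2) - β‖ := by congr 1; linear_combination -β * hdetC
      _ ≤ q.2 * ‖β * p.1 + γ * p.2‖ + ‖β‖ := (norm_sub_le _ _).trans_eq (by
          rw [norm_mul, Complex.norm_intCast, abs_of_nonneg (by exact_mod_cast hq₀)])
      _ ≤ p.2 * ‖β * p.1 + γ * p.2‖ + ‖β‖ := by gcongr
  calc ‖β * q.1 + γ * q.2‖ ≤ ‖β * p.1 + γ * p.2‖ * (1 + 2 * (proximity β γ p / p.2)) := by
        refine le_of_mul_le_mul_left (hscaled.trans_eq ?_) (one_pos.trans_le hyR)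
        rw [hβ]; field_simp
    _ ≤ ‖β * p.1 + γ * p.2‖ * (3 * max 1 (proximity β γ p / p.2)) := by
        gcongr
        linarith [le_max_left 1 (proximity β γ p / p.2), le_max_right 1 (proximity β γ p / p.2)]
    _ = _ := by ring

theorem pow_card_le_prod_max_one_proximity_div {ι : Type*} [Fintype ι] {β γ : ι → ℂ} {m : ℝ}
    {p : ℤ × ℤ} (hcop : IsCoprime p.1 p.2) (hy : 1 ≤ p.2)
    (hp : ∀ i, β i * p.1 + γ i * p.2 ≠ 0) (hle : ∏ i, ‖β i * p.1 + γ i * p.2‖ ≤ m)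
    (hM : ∀ q : ℤ × ℤ, p.1 * q.2 - q.1 * p.2 = 1 → 9 ^ Fintype.card ι * m ≤
      ∏ i, max ‖β i * p.1 + γ i * p.2‖ ‖β i * q.1 + γ i * q.2‖) :
    3 ^ Fintype.card ι ≤ ∏ i, max 1 (proximity (β i) (γ i) p / p.2) := by
  obtain ⟨q, hdet, hq₀, hq⟩ := exists_det_eq_one hcop hy
  have hm : 0 < m := (Finset.prod_pos fun i _ => norm_pos_iff.2 (hp i)).trans_le hle
  have hstep (i : ι) : max ‖β i * p.1 + γ i * p.2‖ ‖β i * q.1 + γ i * q.2‖ ≤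
      3 * ‖β i * p.1 + γ i * p.2‖ * max 1 (proximity (β i) (γ i) p / p.2) := by
    refine max_le ?_ (norm_le_mul_max_one_proximity_div hy hdet hq₀ hq (hp i))
    exact (le_mul_of_one_le_left (norm_nonneg _) (by norm_num)).trans
      (le_mul_of_one_le_right (by positivity) (le_max_left _ _))
  have hchain := calc (9 : ℝ) ^ Fintype.card ι * m
    _ ≤ ∏ i, max ‖β i * p.1 + γ i * p.2‖ ‖β i * q.1 + γ i * q.2‖ := hM q hdet
    _ ≤ ∏ i, 3 * ‖β i * p.1 + γ i * p.2‖ * max 1 (proximity (β i) (γ i) p / p.2) :=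
        Finset.prod_le_prod (fun i _ => by positivity) fun i _ => hstep i
    _ = 3 ^ Fintype.card ι * (∏ i, ‖β i * p.1 + γ i * p.2‖) *
          ∏ i, max 1 (proximity (β i) (γ i) p / p.2) := by
        simp only [Finset.prod_mul_distrib, Finset.prod_const, Finset.card_univ]
    _ ≤ 3 ^ Fintype.card ι * m * ∏ i, max 1 (proximity (β i) (γ i) p / p.2) := by gcongr
  rw [show (9 : ℝ) = 3 * 3 by norm_num, mul_pow, mul_right_comm] at hchain
  exact le_of_mul_le_mul_left hchain (by positivity)

end LinearForms

section Dehomogenization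

theorem natDegree_aeval_X_one_le {R : Type*} [CommSemiring R] {n : ℕ}
    {F : MvPolynomial (Fin 2) R} (hF : F.IsHomogeneous n) :
    (MvPolynomial.aeval ![(X : R[X]), 1] F).natDegree ≤ n := by
  refine (MvPolynomial.aeval_natDegree_le (n := 1) F hF.totalDegree_le _ fun i => ?_).trans_eq
    (mul_one n)
  fin_cases i
  · exact natDegree_X_le
  · simp

theorem eval_aeval_X_one {R : Type*} [CommSemiring R] (F : MvPolynomial (Fin 2) R) (t : R) :
    (MvPolynomial.aeval ![(X : R[X]), 1] F).eval t = MvPolynomial.eval ![t, 1] F := by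
  rw [← coe_aeval_eq_eval t, MvPolynomial.comp_aeval_apply, MvPolynomial.aeval_eq_eval]
  congr 2
  ext i
  fin_cases i <;> simp

theorem derivative_aeval_X_one {R : Type*} [CommSemiring R] (F : MvPolynomial (Fin 2) R) :
    (MvPolynomial.aeval ![(X : R[X]), 1] F).derivative =
      MvPolynomial.aeval ![X, 1] (MvPolynomial.pderiv 0 F) := by
  induction F using MvPolynomial.induction_on with
  | C a => simp
  | add p q hp hq => simp only [map_add, hp, hq]
  | mul_X p i hp =>
    rw [map_mul, derivative_mul, hp, Derivation.leibniz]
    fin_cases i <;> simp [MvPolynomial.pderiv_X, add_comm, mul_comm]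

theorem eval_smul_of_isHomogeneous {σ R : Type*} [CommSemiring R] {n : ℕ} {F : MvPolynomial σ R}
    (hF : F.IsHomogeneous n) (c : R) (v : σ → R) :
    MvPolynomial.eval (c • v) F = c ^ n * MvPolynomial.eval v F := by
  rw [MvPolynomial.eval_eq, MvPolynomial.eval_eq, Finset.mul_sum]
  refine Finset.sum_congr rfl fun d hd => ?_
  have hdeg : ∑ i ∈ d.support, d i = n := by
    simpa [Finsupp.weight_apply, Finsupp.sum] using hF (MvPolynomial.mem_support_iff.1 hd)
  simp only [Pi.smul_apply, smul_eq_mul, mul_pow, Finset.prod_mul_distrib,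
    Finset.prod_pow_eq_pow_sum, hdeg]
  ring

theorem intCast_eval {R : Type*} [CommRing R] (F : MvPolynomial (Fin 2) ℤ) (x y : ℤ) :
    ((MvPolynomial.eval ![x, y] F : ℤ) : R) =
      MvPolynomial.eval ![(x : R), (y : R)] (MvPolynomial.map (Int.castRingHom R) F) := by
  rw [MvPolynomial.eval_map, ← eq_intCast (Int.castRingHom R), MvPolynomial.eval,
    MvPolynomial.coe_eval₂Hom, MvPolynomial.hom_eval₂, RingHom.comp_id]
  congr 1
  ext i
  fin_cases i <;> rfl

theorem aeval_aeval_X_one_toReal (F : MvPolynomial (Fin 2) ℤ) (α : ℂ) :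
    aeval α (MvPolynomial.aeval ![(X : ℝ[X]), 1] (toReal F)) =
      MvPolynomial.eval ![α, 1] (MvPolynomial.map (Int.castRingHom ℂ) F) := by
  rw [MvPolynomial.comp_aeval_apply, toReal, MvPolynomial.aeval_def, MvPolynomial.eval₂_map,
    RingHom.ext_int ((algebraMap ℝ ℂ).comp _) (Int.castRingHom ℂ), MvPolynomial.eval_map]
  congr 1
  ext i
  fin_cases i <;> simp

theorem eval_toReal_div_pos {n : ℕ} {F : MvPolynomial (Fin 2) ℤ} (hF : F.IsHomogeneous n)
    {x y : ℤ} (hy : 1 ≤ y) (hpos : 0 < MvPolynomial.eval ![x, y] F) :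
    0 < MvPolynomial.eval ![(x / y : ℝ), 1] (toReal F) := by
  have hyR : (0 : ℝ) < y := by exact_mod_cast hy
  have hscale : ![(x : ℝ), (y : ℝ)] = (y : ℝ) • ![(x / y : ℝ), 1] := by
    ext i
    fin_cases i <;> simp [mul_div_cancel₀ _ hyR.ne']
  have hval : (0 : ℝ) < (y : ℝ) ^ n * MvPolynomial.eval ![(x / y : ℝ), 1] (toReal F) := by
    rw [toReal, ← eval_smul_of_isHomogeneous (hF.map _), ← hscale, ← intCast_eval]
    exact_mod_cast hpos
  exact pos_of_mul_pos_right hval (by positivity)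

end Dehomogenization

section SplitForms

/-- The product of the linear forms `β i * x + γ i * y`. Unlike a factorization into factors
`x - α i * y` and a constant, it leaves room for the roots at infinity. -/
noncomputable def splitForm {ι R : Type*} [Fintype ι] [CommSemiring R] (β γ : ι → R) :
    MvPolynomial (Fin 2) R :=
  ∏ i, (MvPolynomial.C (β i) * MvPolynomial.X 0 + MvPolynomial.C (γ i) * MvPolynomial.X 1)

theorem homogenize_C_mul_X_add_C {R : Type*} [CommSemiring R] (a b : R) :
    (C a * X + C b).homogenize 1 =
      MvPolynomial.C a * MvPolynomial.X 0 + MvPolynomial.C b * MvPolynomial.X 1 := by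
  simp [homogenize_add, homogenize_C_mul, homogenize_X, homogenize_C]

theorem exists_eq_linear_mul {K : Type*} [Field K] [IsAlgClosed K] {n : ℕ} {f : K[X]}
    (hf : f.natDegree ≤ n + 1) :
    ∃ (a b : K) (g : K[X]), g.natDegree ≤ n ∧ f = (C a * X + C b) * g := by
  rcases hf.lt_or_eq with hlt | heq
  · exact ⟨0, 1, f, Nat.le_of_lt_succ hlt, by simp⟩
  · obtain ⟨r, hr⟩ := IsAlgClosed.exists_root f (natDegree_pos_iff_degree_pos.1 (by omega)).ne'
    obtain ⟨g, rfl⟩ := dvd_iff_isRoot.2 hr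
    have hg : g ≠ 0 := by rintro rfl; simp at heq
    rw [(monic_X_sub_C r).natDegree_mul' hg, natDegree_X_sub_C] at heq
    exact ⟨1, -r, g, by omega, by simp [sub_eq_add_neg]⟩

theorem exists_homogenize_eq_splitForm {K : Type*} [Field K] [IsAlgClosed K] {n : ℕ}
    (hn : 1 ≤ n) {f : K[X]} (hf : f.natDegree ≤ n) :
    ∃ β γ : Fin n → K, f.homogenize n = splitForm β γ := by
  induction n, hn using Nat.le_induction generalizing f with
  | base =>
    obtain ⟨a, b, rfl⟩ := exists_eq_X_add_C_of_natDegree_le_one hf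
    refine ⟨fun _ => a, fun _ => b, ?_⟩
    rw [homogenize_C_mul_X_add_C, splitForm, Fin.prod_univ_one]
  | succ n _ ih =>
    obtain ⟨a, b, g, hg, rfl⟩ := exists_eq_linear_mul hf
    obtain ⟨β, γ, hβγ⟩ := ih hg
    refine ⟨Fin.cons a β, Fin.cons b γ, ?_⟩
    have hmul := homogenize_mul (C a * X + C b) g natDegree_linear_le hg
    rw [add_comm 1 n, homogenize_C_mul_X_add_C, hβγ] at hmul
    rw [hmul, splitForm, splitForm, Fin.prod_univ_succ]
    simp only [Fin.cons_zero, Fin.cons_succ]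

theorem exists_eq_splitForm {K : Type*} [Field K] [IsAlgClosed K] {n : ℕ} (hn : 1 ≤ n)
    {F : MvPolynomial (Fin 2) K} (hF : F.IsHomogeneous n) :
    ∃ β γ : Fin n → K, F = splitForm β γ := by
  rw [← homogenize_eq_of_isHomogeneous hF rfl]
  exact exists_homogenize_eq_splitForm hn (natDegree_aeval_X_one_le hF)

theorem aeval_eq_prod_of_map_eq_splitForm {ι A : Type*} [Fintype ι] [CommRing A] [Algebra ℂ A]
    [Algebra ℤ A] {F : MvPolynomial (Fin 2) ℤ} {β γ : ι → ℂ}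
    (hF : MvPolynomial.map (Int.castRingHom ℂ) F = splitForm β γ) (g : Fin 2 → A) :
    MvPolynomial.aeval g F = ∏ i, (algebraMap ℂ A (β i) * g 0 + algebraMap ℂ A (γ i) * g 1) := by
  have heval := congrArg (MvPolynomial.eval₂ (algebraMap ℂ A) g) hF
  rw [MvPolynomial.eval₂_map,
    RingHom.ext_int ((algebraMap ℂ A).comp (Int.castRingHom ℂ)) (algebraMap ℤ A)] at heval
  rw [MvPolynomial.aeval_def, heval, splitForm, ← MvPolynomial.coe_eval₂Hom, map_prod]
  simp

end SplitForms

section MahlerMeasure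

theorem mahlerMeasure_prod {ι : Type*} (s : Finset ι) (p : ι → ℂ[X]) :
    (∏ i ∈ s, p i).mahlerMeasure = ∏ i ∈ s, (p i).mahlerMeasure := by
  rw [Finset.prod, prod_mahlerMeasure_eq_mahlerMeasure_prod, Multiset.map_map]
  rfl

theorem mahlerMeasure_C_mul_X_add_C_eq_max (a b : ℂ) :
    (C a * X + C b).mahlerMeasure = max ‖a‖ ‖b‖ := by
  rcases eq_or_ne a 0 with rfl | ha
  · simp
  · exact mahlerMeasure_C_mul_X_add_C ha b

theorem mahler_act {ι : Type*} [Fintype ι] {F : MvPolynomial (Fin 2) ℤ} {β γ : ι → ℂ}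
    (hF : MvPolynomial.map (Int.castRingHom ℂ) F = splitForm β γ)
    (A : Matrix (Fin 2) (Fin 2) ℤ) :
    mahler (act A F) =
      ∏ i, max ‖β i * A 0 0 + γ i * A 1 0‖ ‖β i * A 0 1 + γ i * A 1 1‖ := by
  rw [mahler, act, MvPolynomial.aeval_bind₁, aeval_eq_prod_of_map_eq_splitForm hF,
    mahlerMeasure_prod]
  refine Finset.prod_congr rfl fun i _ => ?_
  rw [← mahlerMeasure_C_mul_X_add_C_eq_max]
  congr 1
  simp only [algebraMap_eq, eq_intCast, map_add, map_mul, map_intCast, MvPolynomial.aeval_X,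
    Matrix.cons_val_zero, Matrix.cons_val_one, Matrix.cons_val_fin_one, mul_one]
  ring

theorem minMahler_nonneg (F : MvPolynomial (Fin 2) ℤ) : 0 ≤ minMahler F := by
  refine Real.sInf_nonneg ?_
  rintro _ ⟨G, -, rfl⟩
  exact mahlerMeasure_nonneg _

theorem minMahler_le_mahler_act (F : MvPolynomial (Fin 2) ℤ)
    (A : Matrix.GeneralLinearGroup (Fin 2) ℤ) : minMahler F ≤ mahler (act A F) := by
  refine csInf_le ⟨0, ?_⟩ ⟨_, ⟨A, .inl rfl⟩, rfl⟩
  rintro _ ⟨G, -, rfl⟩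
  exact mahlerMeasure_nonneg _

end MahlerMeasure

section PrimitivePoints

/-- The primitive points `(x, y)` of height `1 ≤ y ≤ Y` at which `0 < F(x, y) ≤ m`. -/
def primitivePoints (F : MvPolynomial (Fin 2) ℤ) (m Y : ℝ) : Set (ℤ × ℤ) :=
  {p | IsCoprime p.1 p.2 ∧ 1 ≤ p.2 ∧ (p.2 : ℝ) ≤ Y ∧
    0 < MvPolynomial.eval ![p.1, p.2] F ∧ (MvPolynomial.eval ![p.1, p.2] F : ℝ) ≤ m}

variable {F : MvPolynomial (Fin 2) ℤ} {m Y : ℝ}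

theorem inv_mul_le_abs_div_sub_div {p q : ℤ × ℤ} (hp : p ∈ primitivePoints F m Y)
    (hq : q ∈ primitivePoints F m Y) (hpq : p ≠ q) :
    (p.2 * Y)⁻¹ ≤ |(p.1 / p.2 - q.1 / q.2 : ℝ)| := by
  obtain ⟨hpcop, hp₂, -⟩ := hp
  obtain ⟨hqcop, hq₂, hqY, -⟩ := hq
  have hpR : (0 : ℝ) < p.2 := by exact_mod_cast hp₂
  have hqR : (0 : ℝ) < q.2 := by exact_mod_cast hq₂
  have hdet : (1 : ℝ) ≤ |(p.1 * q.2 - q.1 * p.2 : ℝ)| := by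
    exact_mod_cast Int.one_le_abs (det_ne_zero_of_isCoprime hpcop hqcop hp₂ hq₂ hpq)
  rw [div_sub_div _ _ hpR.ne' hqR.ne', mul_comm (p.2 : ℝ) q.1, abs_div,
    abs_of_pos (mul_pos hpR hqR), inv_eq_one_div]
  gcongr

theorem injOn_div_primitivePoints :
    Set.InjOn (fun p : ℤ × ℤ => (p.1 / p.2 : ℝ)) (primitivePoints F m Y) := by
  intro p hp q hq heq
  by_contra hpq
  have hp₂ : (0 : ℝ) < p.2 := by exact_mod_cast hp.2.1
  have hsep := inv_mul_le_abs_div_sub_div hp hq hpq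
  rw [sub_eq_zero.2 heq, abs_zero] at hsep
  exact hsep.not_gt (inv_pos.2 (mul_pos hp₂ (hp₂.trans_le hp.2.2.1)))

theorem inv_mul_le_mul_norm_sub_root {n : ℕ} (hF : F.IsHomogeneous n) {p q r : ℤ × ℤ}
    (hp : p ∈ primitivePoints F m Y) (hq : q ∈ primitivePoints F m Y)
    (hr : r ∈ primitivePoints F m Y) (hqp : (q.1 / q.2 : ℝ) < p.1 / p.2)
    (hpr : (p.1 / p.2 : ℝ) < r.1 / r.2)
    (hcrit : ∀ t ∈ Set.Ioo (q.1 / q.2 : ℝ) (r.1 / r.2),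
      MvPolynomial.eval ![t, 1] (MvPolynomial.pderiv 0 (toReal F)) ≠ 0) {α : ℂ}
    (hα : MvPolynomial.eval ![α, 1] (MvPolynomial.map (Int.castRingHom ℂ) F) = 0) :
    (p.2 * Y)⁻¹ ≤ 144 * (n : ℝ) ^ 4 * ‖((p.1 / p.2 : ℝ) - α : ℂ)‖ := by
  have heval_pos {z : ℤ × ℤ} (hz : z ∈ primitivePoints F m Y) :
      0 < (MvPolynomial.aeval ![(X : ℝ[X]), 1] (toReal F)).eval (z.1 / z.2 : ℝ) := by
    rw [eval_aeval_X_one]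
    exact eval_toReal_div_pos hF hz.2.1 hz.2.2.2.1
  refine le_trans (le_min ?_ ?_) (min_sub_le_mul_norm_sub_root
    (natDegree_aeval_X_one_le (hF.map _)) hqp hpr (heval_pos hq) (heval_pos hp) (heval_pos hr)
    (fun t ht => ?_) ((aeval_aeval_X_one_toReal F α).trans hα))
  · rw [← abs_of_pos (sub_pos.2 hqp)]
    exact inv_mul_le_abs_div_sub_div hp hq (by rintro rfl; exact hqp.false)
  · rw [← abs_of_pos (sub_pos.2 hpr), abs_sub_comm]
    exact inv_mul_le_abs_div_sub_div hp hr (by rintro rfl; exact hpr.false)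
  · rw [derivative_aeval_X_one, eval_aeval_X_one]
    exact hcrit t ht

theorem proximity_le {n : ℕ} (hF : F.IsHomogeneous n) {ι : Type*} [Fintype ι] {β γ : ι → ℂ}
    (hsplit : MvPolynomial.map (Int.castRingHom ℂ) F = splitForm β γ) {p q r : ℤ × ℤ}
    (hp : p ∈ primitivePoints F m Y) (hq : q ∈ primitivePoints F m Y)
    (hr : r ∈ primitivePoints F m Y) (hqp : (q.1 / q.2 : ℝ) < p.1 / p.2)
    (hpr : (p.1 / p.2 : ℝ) < r.1 / r.2)
    (hcrit : ∀ t ∈ Set.Ioo (q.1 / q.2 : ℝ) (r.1 / r.2),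
      MvPolynomial.eval ![t, 1] (MvPolynomial.pderiv 0 (toReal F)) ≠ 0) (i : ι) :
    proximity (β i) (γ i) p ≤ 72 * (n : ℝ) ^ 4 * Y := by
  have hp₂ : (0 : ℝ) < p.2 := by exact_mod_cast hp.2.1
  have hY : 0 < Y := hp₂.trans_le hp.2.2.1
  rcases eq_or_ne (β i) 0 with hβ | hβ
  · rw [proximity, hβ, norm_zero, zero_div]
    positivity
  have hroot : MvPolynomial.eval ![-γ i / β i, 1] (splitForm β γ) = 0 := by
    rw [splitForm, map_prod]
    exact Finset.prod_eq_zero (Finset.mem_univ i) (by simp [mul_div_cancel₀ _ hβ])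
  have hdist := inv_mul_le_mul_norm_sub_root hF hp hq hr hqp hpr hcrit (hsplit ▸ hroot)
  rw [inv_le_iff_one_le_mul₀ (by positivity)] at hdist
  have hform : β i * p.1 + γ i * p.2 = β i * (p.2 * ((p.1 / p.2 : ℝ) - -γ i / β i)) := by
    have hp₂' : (p.2 : ℂ) ≠ 0 := by exact_mod_cast hp₂.ne'
    push_cast
    field_simp
    ring
  rw [proximity, hform, norm_mul, norm_mul, Complex.norm_intCast, abs_of_pos hp₂]
  refine div_le_of_le_mul₀ (by positivity) (by positivity) ?_
  linarith [le_mul_of_one_le_right (norm_nonneg (β i)) hdist]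

theorem card_le_log_of_proximity_le {ι : Type*} [Fintype ι] [Nonempty ι] {β γ : ι → ℂ}
    {T : Finset (ℤ × ℤ)} {B : ℝ} (hB : 1 ≤ B) (hcop : ∀ p ∈ T, IsCoprime p.1 p.2)
    (hy : ∀ p ∈ T, 1 ≤ p.2) (hT : ∀ p ∈ T, ∀ i, proximity (β i) (γ i) p ≤ B)
    (hlarge : ∀ p ∈ T,
      3 ^ Fintype.card ι ≤ ∏ i, max 1 (proximity (β i) (γ i) p / p.2)) :
    (T.card : ℝ) ≤ Real.log B := by
  have hpow : ((3 : ℝ) ^ T.card) ^ Fintype.card ι ≤ B ^ Fintype.card ι :=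
    calc ((3 : ℝ) ^ T.card) ^ Fintype.card ι = ∏ _p ∈ T, (3 : ℝ) ^ Fintype.card ι := by
          rw [Finset.prod_const, pow_right_comm]
      _ ≤ ∏ p ∈ T, ∏ i, max 1 (proximity (β i) (γ i) p / p.2) :=
          Finset.prod_le_prod (fun p _ => by positivity) hlarge
      _ = ∏ i, ∏ p ∈ T, max 1 (proximity (β i) (γ i) p / p.2) := Finset.prod_comm
      _ ≤ ∏ _i : ι, B :=
          Finset.prod_le_prod (fun i _ => Finset.prod_nonneg fun p _ => by positivity)
            fun i _ => prod_max_one_proximity_div_le _ _ hB hcop hy fun p hp => hT p hp i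
      _ = B ^ Fintype.card ι := by rw [Finset.prod_const, Finset.card_univ]
  have hle := le_of_pow_le_pow_left₀ Fintype.card_ne_zero (by linarith) hpow
  rw [Real.le_log_iff_exp_le (by linarith), ← mul_one (T.card : ℝ), Real.exp_nat_mul]
  exact (pow_le_pow_left₀ (Real.exp_pos 1).le (by linarith [Real.exp_one_lt_d9]) _).trans hle

theorem pow_card_le_prod_max_one_proximity_div_of_mem {ι : Type*} [Fintype ι] {β γ : ι → ℂ}
    (hsplit : MvPolynomial.map (Int.castRingHom ℂ) F = splitForm β γ)
    (hM : ∀ A : Matrix.GeneralLinearGroup (Fin 2) ℤ, 9 ^ Fintype.card ι * m ≤ mahler (act A F))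
    {p : ℤ × ℤ} (hp : p ∈ primitivePoints F m Y) :
    3 ^ Fintype.card ι ≤ ∏ i, max 1 (proximity (β i) (γ i) p / p.2) := by
  obtain ⟨hcop, hy, -, hpos, hle⟩ := hp
  have hval : ((MvPolynomial.eval ![p.1, p.2] F : ℤ) : ℂ) = ∏ i, (β i * p.1 + γ i * p.2) := by
    rw [intCast_eval, hsplit, splitForm, map_prod]
    simp
  refine pow_card_le_prod_max_one_proximity_div (m := m) hcop hy (fun i hi => hpos.ne' ?_) ?_
    fun q hq => ?_
  · rw [Finset.prod_eq_zero (Finset.mem_univ i) hi] at hval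
    exact_mod_cast hval
  · rwa [← norm_prod, ← hval, Complex.norm_intCast, abs_of_pos (by exact_mod_cast hpos)]
  · have hdet : IsUnit (!![p.1, q.1; p.2, q.2] : Matrix (Fin 2) (Fin 2) ℤ).det := by
      rw [Matrix.det_fin_two_of, hq]
      exact isUnit_one
    simpa [mahler_act hsplit] using hM (Matrix.GeneralLinearGroup.mk'' _ hdet)

theorem card_le_of_subset_primitivePoints {n k : ℕ} (hn : 1 ≤ n) (hF : F.IsHomogeneous n)
    (hZ : {t : ℝ | MvPolynomial.eval ![t, 1] (MvPolynomial.pderiv 0 (toReal F)) = 0}.encard ≤ k)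
    (hM : ∀ A : Matrix.GeneralLinearGroup (Fin 2) ℤ, 9 ^ n * m ≤ mahler (act A F))
    (hY : 1 ≤ Y) {T : Finset (ℤ × ℤ)} (hT : ↑T ⊆ primitivePoints F m Y) :
    (T.card : ℝ) ≤ 2 * k + 2 + Real.log (72 * (n : ℝ) ^ 4 * Y) := by
  obtain ⟨β, γ, hsplit⟩ := exists_eq_splitForm hn (hF.map (Int.castRingHom ℂ))
  obtain ⟨Z, hZeq⟩ := (Set.finite_of_encard_le_coe hZ).exists_finset_coe
  have hZk : (Z.card : ℝ) ≤ k := by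
    rw [← hZeq, Set.encard_coe_eq_coe_finsetCard] at hZ
    exact_mod_cast hZ
  obtain ⟨T', hT', hcard, hneigh⟩ :=
    exists_subset_forall_neighbours (injOn_div_primitivePoints.mono hT) Z
  have hprox : ∀ p ∈ T', ∀ i, proximity (β i) (γ i) p ≤ 72 * (n : ℝ) ^ 4 * Y := by
    intro p hp i
    obtain ⟨q, hq, r, hr, hqp, hpr, hqr⟩ := hneigh p hp
    refine proximity_le hF hsplit (hT (hT' hp)) (hT hq) (hT hr) hqp hpr (fun t ht hzero => ?_) i
    exact hqr t (Finset.mem_coe.1 (hZeq ▸ hzero)) ht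
  have : Nonempty (Fin n) := ⟨⟨0, hn⟩⟩
  have hB : 1 ≤ 72 * (n : ℝ) ^ 4 * Y := by
    have hnR : (1 : ℝ) ≤ n := by exact_mod_cast hn
    exact one_le_mul_of_one_le_of_one_le
      (one_le_mul_of_one_le_of_one_le (by norm_num) (one_le_pow₀ hnR)) hY
  have hlog := card_le_log_of_proximity_le hB (fun p hp => (hT (hT' hp)).1)
    (fun p hp => (hT (hT' hp)).2.1) hprox fun p hp =>
      pow_card_le_prod_max_one_proximity_div_of_mem hsplit (by simpa using hM) (hT (hT' hp))
  have hcardR : (T.card : ℝ) ≤ T'.card + (2 * Z.card + 2) := by exact_mod_cast hcard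
  linarith

end PrimitivePoints

section SmallSolutions

theorem finite_and_ncard_le_of_forall_card_le {α : Type*} {S : Set α} {c : ℝ}
    (h : ∀ T : Finset α, ↑T ⊆ S → (T.card : ℝ) ≤ c) : S.Finite ∧ (S.ncard : ℝ) ≤ c := by
  have hfin : S.Finite := by
    by_contra hinf
    obtain ⟨T, hT, hcard⟩ := Set.Infinite.exists_subset_card_eq hinf (⌊c⌋₊ + 1)
    have hle := h T hT
    rw [hcard] at hle
    push_cast at hle
    exact hle.not_gt (Nat.lt_floor_add_one c)
  refine ⟨hfin, ?_⟩
  rw [Set.ncard_eq_toFinset_card S hfin]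
  exact h _ hfin.coe_toFinset.subset

theorem one_le_R {n : ℕ} (hn : 1 ≤ n) : 1 ≤ R n :=
  Real.one_le_rpow (by exact_mod_cast hn) (by positivity)

theorem log_R {n : ℕ} (hn : 1 ≤ n) : Real.log (R n) = 800 * Real.log n ^ 3 := by
  rw [R, Real.log_rpow (by exact_mod_cast hn)]
  ring

theorem one_le_base_YS {n s m : ℕ} (hn : 1 ≤ n) (hs : 1 ≤ s) (hm : 1 ≤ m) :
    1 ≤ (Real.exp 6 * s) ^ n * R n ^ (2 * s) * m := by
  have hexp : 1 ≤ Real.exp 6 * s :=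
    one_le_mul_of_one_le_of_one_le (Real.one_le_exp (by norm_num)) (by exact_mod_cast hs)
  exact one_le_mul_of_one_le_of_one_le
    (one_le_mul_of_one_le_of_one_le (one_le_pow₀ hexp) (one_le_pow₀ (one_le_R hn)))
    (by exact_mod_cast hm)

theorem one_le_YS {n s m : ℕ} (hs : 1 ≤ s) (hn : 3 * s ≤ n) (hm : 1 ≤ m) : 1 ≤ YS n s m := by
  have hnR : 3 * (s : ℝ) ≤ n := by exact_mod_cast hn
  refine Real.one_le_rpow (one_le_base_YS (by omega) hs hm) (one_div_nonneg.2 ?_)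
  linarith [s.cast_nonneg (α := ℝ)]

theorem log_base_YS {n s m : ℕ} (hn : 1 ≤ n) (hs : 1 ≤ s) (hm : 1 ≤ m) :
    Real.log ((Real.exp 6 * s) ^ n * R n ^ (2 * s) * m) =
      n * (6 + Real.log s) + 2 * s * (800 * Real.log n ^ 3) + Real.log m := by
  have hsR : (s : ℝ) ≠ 0 := by exact_mod_cast (by omega : s ≠ 0)
  have hmR : (m : ℝ) ≠ 0 := by exact_mod_cast (by omega : m ≠ 0)
  have hR : R n ≠ 0 := (one_pos.trans_le (one_le_R hn)).ne'
  rw [Real.log_mul (by positivity) hmR, Real.log_mul (by positivity) (by positivity),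
    Real.log_pow, Real.log_pow, Real.log_mul (by positivity) hsR, Real.log_exp, log_R hn]
  push_cast
  ring

theorem log_YS_le {n s m : ℕ} (hs : 1 ≤ s) (hn : 3 * s ≤ n) (hm : 1 ≤ m) :
    Real.log (YS n s m) ≤
      21 * s + 1600 * Real.log n ^ 3 + 3 * Real.log ((m : ℝ) ^ (1 / (n : ℝ))) := by
  have hsR : (1 : ℝ) ≤ s := by exact_mod_cast hs
  have hnR : 3 * (s : ℝ) ≤ n := by exact_mod_cast hn
  have hn₀ : (0 : ℝ) < n := by linarith
  have hbase := one_le_base_YS (by omega : 1 ≤ n) hs hm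
  have hexponent : 1 / ((n : ℝ) - 2 * s) ≤ 3 / n := by
    rw [div_le_div_iff₀ (by linarith) hn₀]
    linarith
  rw [YS, Real.log_rpow (one_pos.trans_le hbase), Real.log_rpow (by exact_mod_cast hm)]
  calc 1 / ((n : ℝ) - 2 * s) * Real.log ((Real.exp 6 * s) ^ n * R n ^ (2 * s) * m)
      ≤ 3 / n * Real.log ((Real.exp 6 * s) ^ n * R n ^ (2 * s) * m) :=
        mul_le_mul_of_nonneg_right hexponent (Real.log_nonneg hbase)
    _ = 18 + 3 * Real.log s + 1600 * Real.log n ^ 3 * (3 * s / n) +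
          3 * (1 / n * Real.log m) := by
        rw [log_base_YS (by omega) hs hm]
        field_simp
        ring
    _ ≤ 18 + 3 * s + 1600 * Real.log n ^ 3 * 1 + 3 * (1 / n * Real.log m) := by
        gcongr
        · exact Real.log_le_self (by linarith)
        · rwa [div_le_one hn₀]
    _ ≤ 21 * s + 1600 * Real.log n ^ 3 + 3 * (1 / n * Real.log m) := by linarith

theorem card_le_two_of_isCoprime_of_snd_eq_zero {T : Finset (ℤ × ℤ)}
    (hT : ∀ p ∈ T, IsCoprime p.1 p.2 ∧ p.2 = 0) : T.card ≤ 2 := by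
  refine (Finset.card_le_card fun p hp => ?_).trans
    (Finset.card_le_two (a := ((1 : ℤ), (0 : ℤ))) (b := (-1, 0)))
  obtain ⟨hcop, hp₂⟩ := hT p hp
  rw [hp₂, isCoprime_zero_right, Int.isUnit_iff] at hcop
  simpa [Prod.ext_iff, hp₂] using hcop

theorem mem_primitivePoints_of_mem_smallY {n s m : ℕ} {F : MvPolynomial (Fin 2) ℤ} {p : ℤ × ℤ}
    (hm : 1 ≤ m) (hp : p ∈ smallY n s m F) (hp₂ : 1 ≤ p.2) :
    p ∈ primitivePoints F m (YS n s m) := by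
  obtain ⟨⟨hcop, hlow, hlt⟩, -, hY⟩ := hp
  have hpos : (0 : ℝ) < (2 : ℝ) ^ (-(n : ℤ)) * m := by positivity
  exact ⟨hcop, hp₂, hY, by exact_mod_cast hpos.trans_le hlow, hlt.le⟩

theorem card_le_of_subset_smallY {n s m k : ℕ} (hs : 1 ≤ s) (hn : 3 * s ≤ n) (hm : 1 ≤ m)
    {F : MvPolynomial (Fin 2) ℤ} (hF : F.IsHomogeneous n)
    (hZ : {t : ℝ | MvPolynomial.eval ![t, 1] (MvPolynomial.pderiv 0 (toReal F)) = 0}.encard ≤ k)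
    (hM : ∀ A : Matrix.GeneralLinearGroup (Fin 2) ℤ, 9 ^ n * (m : ℝ) ≤ mahler (act A F))
    {T : Finset (ℤ × ℤ)} (hT : ↑T ⊆ smallY n s m F) :
    (T.card : ℝ) ≤ 2 * k + 4 + Real.log (72 * (n : ℝ) ^ 4 * YS n s m) := by
  have hzero : (T.filter (¬1 ≤ ·.2)).card ≤ 2 := by
    refine card_le_two_of_isCoprime_of_snd_eq_zero fun p hp => ?_
    obtain ⟨hpT, hp₂⟩ := Finset.mem_filter.1 hp
    obtain ⟨⟨hcop, -⟩, hnonneg, -⟩ := hT hpT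
    exact ⟨hcop, by omega⟩
  have hpos := card_le_of_subset_primitivePoints (by omega) hF hZ hM (one_le_YS hs hn hm)
    (T := T.filter (1 ≤ ·.2)) fun p hp =>
      mem_primitivePoints_of_mem_smallY hm (hT (Finset.mem_filter.1 hp).1)
        (Finset.mem_filter.1 hp).2
  have hsum : (T.card : ℝ) ≤ (T.filter (1 ≤ ·.2)).card + 2 := by
    rw [← Finset.card_filter_add_card_filter_not (s := T) (1 ≤ ·.2)]
    exact_mod_cast Nat.add_le_add_left hzero _
  linarith

theorem log_mul_YS_le {n s m : ℕ} (hs : 1 ≤ s) (hn : 3 * s ≤ n) (hm : 1 ≤ m) :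
    2 * (4 * s) + 4 + Real.log (72 * (n : ℝ) ^ 4 * YS n s m) ≤
      2000 * (s + Real.log n ^ 3 + Real.log ((m : ℝ) ^ (1 / (n : ℝ)))) := by
  have hsR : (1 : ℝ) ≤ s := by exact_mod_cast hs
  have hnR : (3 : ℝ) ≤ n := by exact_mod_cast (by omega : 3 ≤ n)
  have hlogn : 1 ≤ Real.log n := by
    rw [Real.le_log_iff_exp_le (by linarith)]
    linarith [Real.exp_one_lt_d9]
  have hlogm : 0 ≤ Real.log ((m : ℝ) ^ (1 / (n : ℝ))) :=
    Real.log_nonneg (Real.one_le_rpow (by exact_mod_cast hm) (by positivity))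
  have hY : YS n s m ≠ 0 := (one_pos.trans_le (one_le_YS hs hn hm)).ne'
  rw [Real.log_mul (by positivity) hY, Real.log_mul (by positivity) (by positivity), Real.log_pow]
  push_cast
  linarith [log_YS_le hs hn hm, Real.log_le_self (x := 72) (by norm_num),
    le_self_pow₀ hlogn three_ne_zero]

theorem smallY_finite_and_ncard_le {n s m : ℕ} (hs : 1 ≤ s) (hn : 3 * s ≤ n) (hm : 1 ≤ m)
    {F : MvPolynomial (Fin 2) ℤ} (hF : F.IsHomogeneous n)
    (hZ : {t : ℝ | MvPolynomial.eval ![t, 1] (MvPolynomial.pderiv 0 (toReal F)) = 0}.encard ≤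
      (4 * s : ℕ))
    (hM : ∀ A : Matrix.GeneralLinearGroup (Fin 2) ℤ, 9 ^ n * (m : ℝ) ≤ mahler (act A F)) :
    (smallY n s m F).Finite ∧ ((smallY n s m F).ncard : ℝ) ≤
      2000 * (s + Real.log n ^ 3 + Real.log ((m : ℝ) ^ (1 / (n : ℝ)))) := by
  refine finite_and_ncard_le_of_forall_card_le fun T hT => ?_
  have hcard := card_le_of_subset_smallY hs hn hm hF hZ hM hT
  push_cast at hcard
  exact hcard.trans (log_mul_YS_le hs hn hm)

end SmallSolutions

section AffineCharts

theorem encard_le_encard_realZeros {d : ℕ} {G : MvPolynomial (Fin 2) ℝ} (hG : G.IsHomogeneous d)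
    {φ : ℝ → Fin 2 → ℝ} {i : Fin 2} (hφ : ∀ t, φ t i = 1) (hinj : Function.Injective φ) :
    {t : ℝ | MvPolynomial.eval (φ t) G = 0}.encard ≤ (realZeros G).encard := by
  have hne (t : ℝ) : φ t ≠ 0 := fun h => one_ne_zero ((hφ t).symm.trans (congrFun h i))
  refine Set.encard_le_encard_of_injOn (f := fun t => Projectivization.mk ℝ (φ t) (hne t)) ?_ ?_
  · intro t ht v hv
    rw [Projectivization.submodule_mk, Submodule.mem_span_singleton] at hv
    obtain ⟨c, rfl⟩ := hv
    have ht₀ : MvPolynomial.eval (φ t) G = 0 := ht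
    rw [eval_smul_of_isHomogeneous hG, ht₀, mul_zero]
  · intro t _ u _ h
    obtain ⟨c, hc⟩ := (Projectivization.mk_eq_mk_iff' ℝ _ _ (hne t) (hne u)).1 h
    have hc₁ : c = 1 := by simpa [hφ] using congrFun hc i
    rw [hc₁, one_smul] at hc
    exact hinj hc.symm

theorem encard_zeros_left_le {d : ℕ} {G : MvPolynomial (Fin 2) ℝ} (hG : G.IsHomogeneous d) :
    {t : ℝ | MvPolynomial.eval ![t, 1] G = 0}.encard ≤ (realZeros G).encard :=
  encard_le_encard_realZeros hG (i := 1) (fun _ => rfl) fun _ _ h => congrFun h 0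

theorem encard_zeros_right_le {d : ℕ} {G : MvPolynomial (Fin 2) ℝ} (hG : G.IsHomogeneous d) :
    {t : ℝ | MvPolynomial.eval ![1, t] G = 0}.encard ≤ (realZeros G).encard :=
  encard_le_encard_realZeros hG (i := 0) (fun _ => rfl) fun _ _ h => congrFun h 1

end AffineCharts

section Swap

/-- The form `F(y, x)`. It reduces the count of solutions with small `x` to that of solutions with
small `y`. -/
noncomputable def swapForm {R : Type*} [CommSemiring R] (F : MvPolynomial (Fin 2) R) :
    MvPolynomial (Fin 2) R :=
  MvPolynomial.rename (Equiv.swap 0 1) F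

theorem eval_swapForm {R : Type*} [CommSemiring R] (F : MvPolynomial (Fin 2) R) (x y : R) :
    MvPolynomial.eval ![x, y] (swapForm F) = MvPolynomial.eval ![y, x] F := by
  rw [swapForm, MvPolynomial.eval_rename]
  congr 2
  ext i
  fin_cases i <;> simp

theorem toReal_swapForm (F : MvPolynomial (Fin 2) ℤ) : toReal (swapForm F) = swapForm (toReal F) :=
  MvPolynomial.map_rename _ _ _

theorem pderiv_zero_swapForm {R : Type*} [CommSemiring R] (F : MvPolynomial (Fin 2) R) :
    MvPolynomial.pderiv 0 (swapForm F) = swapForm (MvPolynomial.pderiv 1 F) := by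
  have hrename := MvPolynomial.pderiv_rename (R := R) (Equiv.swap (0 : Fin 2) 1).injective 1 F
  rwa [Equiv.swap_apply_right] at hrename

theorem act_swapForm (A : Matrix (Fin 2) (Fin 2) ℤ) (F : MvPolynomial (Fin 2) ℤ) :
    act A (swapForm F) = act (A.submatrix (Equiv.swap 0 1) id) F := by
  rw [act, act, swapForm, MvPolynomial.bind₁_rename]
  rfl

theorem minMahler_le_mahler_act_swapForm (F : MvPolynomial (Fin 2) ℤ)
    (A : Matrix.GeneralLinearGroup (Fin 2) ℤ) : minMahler F ≤ mahler (act A (swapForm F)) := by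
  have hdet : IsUnit ((A : Matrix (Fin 2) (Fin 2) ℤ).submatrix (Equiv.swap 0 1) id).det := by
    rw [Matrix.det_permute, Int.cast_id]
    exact (Units.isUnit _).mul (Matrix.isUnits_det_units A)
  rw [act_swapForm]
  exact minMahler_le_mahler_act F (Matrix.GeneralLinearGroup.mk'' _ hdet)

theorem image_swap_smallX (n s m : ℕ) (F : MvPolynomial (Fin 2) ℤ) :
    Prod.swap '' smallX n s m F = smallY n s m (swapForm F) := by
  ext ⟨x, y⟩
  rw [Set.image_swap_eq_preimage_swap]
  simp [smallX, smallY, IsPrimitiveSolution, eval_swapForm, isCoprime_comm]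

end Swap

theorem ClassC.encard_realZeros_pderiv_le {n t : ℕ} {F : MvPolynomial (Fin 2) ℤ}
    (hF : ClassC n t F) (i : Fin 2) :
    (realZeros (MvPolynomial.pderiv i (toReal F))).encard ≤ t := by
  fin_cases i
  · simpa using hF.few_zeros 1 0 (by simp)
  · simpa using hF.few_zeros 0 1 (by simp)

end ThueForms

open ThueForms in
theorem proposition8p3_general :
    ∃ K : ℝ, 0 < K ∧ ∀ (n s m : ℕ) (F : MvPolynomial (Fin 2) ℤ), 1 ≤ s → 3 * s ≤ n → 1 ≤ m →
      F.IsHomogeneous n →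
      (∀ i : Fin 2, (realZeros (MvPolynomial.pderiv i (toReal F))).encard ≤ (4 * s : ℕ)) →
      (m : ℝ) ≤ minMahler F / 9 ^ n →
      (smallX n s m F).Finite ∧ (smallY n s m F).Finite ∧
        (max (smallX n s m F).ncard (smallY n s m F).ncard : ℝ) ≤
          K * ((s : ℝ) + Real.log n ^ 3 + Real.log ((m : ℝ) ^ (1 / (n : ℝ)))) := by
  refine ⟨2000, by norm_num, fun n s m F hs hn hm hF hzeros hM => ?_⟩
  rw [le_div_iff₀' (by positivity)] at hM
  have hderiv (i : Fin 2) : (MvPolynomial.pderiv i (toReal F)).IsHomogeneous (n - 1) :=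
    (hF.map (Int.castRingHom ℝ)).pderiv
  obtain ⟨hfinY, hcardY⟩ := smallY_finite_and_ncard_le hs hn hm hF
    ((encard_zeros_left_le (hderiv 0)).trans (hzeros 0))
    fun A => hM.trans (minMahler_le_mahler_act F A)
  have hzeros_swap : {t : ℝ | MvPolynomial.eval ![t, 1]
      (MvPolynomial.pderiv 0 (toReal (swapForm F))) = 0}.encard ≤ (4 * s : ℕ) := by
    simpa only [toReal_swapForm, pderiv_zero_swapForm, eval_swapForm] using
      (encard_zeros_right_le (hderiv 1)).trans (hzeros 1)
  obtain ⟨hfinX, hcardX⟩ := smallY_finite_and_ncard_le hs hn hm hF.rename_isHomogeneous hzeros_swap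
    fun A => hM.trans (minMahler_le_mahler_act_swapForm F A)
  rw [← swapForm, ← image_swap_smallX] at hfinX hcardX
  rw [Set.ncard_image_of_injective _ Prod.swap_injective] at hcardX
  exact ⟨hfinX.of_finite_image Prod.swap_injective.injOn, hfinY, max_le hcardX hcardY⟩

theorem proposition8p3 :
    ∃ K : ℝ, 0 < K ∧
      ∀ (n s m : ℕ) (F : MvPolynomial (Fin 2) ℤ),
        1 ≤ s → 3 * s ≤ n → 1 ≤ m →
        ThueForms.ClassC n (4 * s - 2) F →
        (m : ℝ) ≤ ThueForms.minMahler F / 100 ^ n →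
        (ThueForms.smallX n s m F).Finite ∧ (ThueForms.smallY n s m F).Finite ∧
        (max (ThueForms.smallX n s m F).ncard (ThueForms.smallY n s m F).ncard : ℝ) ≤
          K * ((s : ℝ) + Real.log n ^ 3 + Real.log ((m : ℝ) ^ (1 / (n : ℝ)))) := by
  obtain ⟨K, hK, h⟩ := proposition8p3_general
  refine ⟨K, hK, fun n s m F hs hn hm hF hM => h n s m F hs hn hm hF.homogeneous
    (fun i => (hF.encard_realZeros_pderiv_le i).trans (by gcongr; omega)) (hM.trans ?_)⟩
  have := ThueForms.minMahler_nonneg F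
  gcongr
  norm_num
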